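/- Let $G$ be a compact topological group with identity $I_d$ (for instance a compact matrix Lie group), whose topology is given by a right-invariant distance $d$; let $\mathcal B_o(x,r)$ denote open balls and $\mu_G$ the Haar measure. Let $\mathcal Y$ be a Hausdorff space that is also a measurable space, on which $G$ acts measurably on the left. Let $h:G\times\mathbb R^p\to\mathcal Y$ be measurable with $g\mapsto h(g,0)$ continuous, and let $K:\mathcal Y\to G$ be measurable with $K(h(I_d,0))=I_d$. Consider the system and the filter $$\chi_{n+1}=\Upsilon W_n\chi_n\Omega_n,\quad Y_n=h(\chi_n,V_n),\qquad \hat\chi'_{n+1}=\Upsilon\hat\chi_n\Omega_n,\quad \hat\chi_{n+1}=K(\hat\chi'_{n+1}Y_{n+1})\,\hat\chi'_{n+1},$$ where $\Upsilon,\Omega_n\in G$ are deterministic, the $W_n\in G$ are i.i.d., the $V_n\in\mathbb R^p$ are i.i.d., and $(W_n)_n$, $(V_n)_n$ and $(\chi_0,\hat\chi_0)$ are independent. Let $\eta_n=\chi_n\hat\chi_n^{-1}$, with law $\mu_n$. Assume that $h$ is left-right equivariant: for all $g,\chi\in G$, $h(\chi g,V_n)\overset{\mathcal L}{=}g^{-1}h(\chi,V_n)$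 and $h(\chi g,0)=g^{-1}h(\chi,0)$. The law of $\eta_n$ then evolves by the homogeneous Markov transition $\eta\mapsto\eta' K(h(\eta',V))^{-1}$, $\eta'=\Upsilon W\eta\Upsilon^{-1}$, with $W,V$ independent of each other and of $\eta$ and distributed as $W_n,V_n$; "stationary" refers to this transition. Assume that for some $\alpha,\varepsilon,\varepsilon'>0$: 1. $\mathbb P(W_n\in U)\ge\varepsilon\,\mu_G(U)$ for every measurable $U\subset\mathcal B_o(I_d,\alpha)$; 2. $\mathbb P\big[gK(h(g,V_n))^{-1}\in\mathcal B_o(gK(h(g,0))^{-1},\tfrac\alpha2)\big]>\varepsilon'$ for every $g\in G$. Let $\gamma'_{n+1}=\Upsilon\gamma_n\Upsilon^{-1}$, $\gamma_{n+1}=\gamma'_{n+1}K(h(\gamma'_{n+1},0))^{-1}$ be the noiseless error. Assume that for $\mu_G$-almost every $\gamma_0\in G$ one has $h(\gamma_n,0)\to h(I_d,0)$, and the map $g\mapsto K(h(g,0))$ is continuous at every point $\gamma'_{n}$, $n\ge1$ (this is automatic if that map is continuous). Assume finally that $S=\{g\in G: h(g,0)=h(I_d,0)\}$ is connected and that $h(\Upsilon,0)=h(I_d,0)$.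 Then there is a unique stationary probability distribution $\pi$ on $G$, and $\|\mu_n-\pi\|_{T.V.}\to0$ for every law of the initial values $(\chi_0,\hat\chi_0)$ (in particular every prior law $\mu_0$ of $\eta_0$) and all inputs $(\Omega_n)_n$. If moreover $W_n$ is isotropic, i.e. $gW_ng^{-1}\overset{\mathcal L}{=}W_n$ for all $g\in G$, then $\pi(\tilde\Upsilon A)=\pi(A)$ for every measurable $A\subset G$ and every $\tilde\Upsilon\in S$ that commutes with $\Upsilon$ and satisfies $h(\tilde\Upsilon,V_n)\overset{\mathcal L}{=}h(I_d,V_n)$. -/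

import Mathlib

open MeasureTheory ProbabilityTheory Filter Topology
open scoped ENNReal

namespace InvariantFilter

/-- The space in which the output noise takes its values. -/
abbrev Noise (p : ℕ) : Type := EuclideanSpace ℝ (Fin p)

section Dynamics

variable {G 𝒴 : Type*} [Group G] [MulAction G 𝒴] {p : ℕ}

/-- State of the system: `χ (n+1) = Υ * W n * χ n * u n`, where the right-hand inputs are `u n`. -/
def state (Υ : G) (u W : ℕ → G) (χ₀ : G) : ℕ → G
  | 0 => χ₀
  | n + 1 => Υ * W n * state Υ u W χ₀ n * u n

/-- Observation `Y n = h (χ n) (V n)`. -/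
def obs (h : G → Noise p → 𝒴) (Υ : G) (u W : ℕ → G) (V : ℕ → Noise p) (χ₀ : G) (n : ℕ) : 𝒴 :=
  h (state Υ u W χ₀ n) (V n)

/-- One prediction step followed by one correction step of the filter with gain function `K`:
`χ̂' = Υ * χ̂ * u` and then `K (χ̂' • Y) * χ̂'`. -/
def filterStep (K : 𝒴 → G) (Υ u : G) (Y : 𝒴) (χhat : G) : G :=
  K ((Υ * χhat * u) • Y) * (Υ * χhat * u)

/-- The corrected estimates `χ̂ n` produced by the filter. -/
def estimate (h : G → Noise p → 𝒴) (K : 𝒴 → G) (Υ : G) (u W : ℕ → G) (V : ℕ → Noise p)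
    (χ₀ χhat₀ : G) : ℕ → G
  | 0 => χhat₀
  | n + 1 => filterStep K Υ (u n) (obs h Υ u W V χ₀ (n + 1)) (estimate h K Υ u W V χ₀ χhat₀ n)

/-- The error `η n = χ n * (χ̂ n)⁻¹`. -/
def error (h : G → Noise p → 𝒴) (K : 𝒴 → G) (Υ : G) (u W : ℕ → G) (V : ℕ → Noise p)
    (χ₀ χhat₀ : G) (n : ℕ) : G :=
  state Υ u W χ₀ n * (estimate h K Υ u W V χ₀ χhat₀ n)⁻¹

/-- The correction of a predicted error `x` under the output noise `v`. -/
def correct (h : G → Noise p → 𝒴) (K : 𝒴 → G) (x : G) (v : Noise p) : G :=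
  x * (K (h x v))⁻¹

/-- The error recursion: `η' = Υ * w * η * Υ⁻¹`, and then `η' * (K (h η' v))⁻¹`. -/
def errorStep (h : G → Noise p → 𝒴) (K : 𝒴 → G) (Υ : G) (x w : G) (v : Noise p) : G :=
  correct h K (Υ * w * x * Υ⁻¹) v

/-- The noiseless error `γ n`, with `γ' = Υ * γ * Υ⁻¹` and `γ (n+1) = γ' * (K (h γ' 0))⁻¹`. -/
def noiseless (h : G → Noise p → 𝒴) (K : 𝒴 → G) (Υ γ₀ : G) : ℕ → G
  | 0 => γ₀
  | n + 1 => correct h K (Υ * noiseless h K Υ γ₀ n * Υ⁻¹) 0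

/-- The noiseless predicted error `γ' (n+1) = Υ * γ n * Υ⁻¹` (here indexed by `n`). -/
def noiselessPred (h : G → Noise p → 𝒴) (K : 𝒴 → G) (Υ γ₀ : G) (n : ℕ) : G :=
  Υ * noiseless h K Υ γ₀ n * Υ⁻¹

/-- The set of elements with the same noiseless output as the identity. -/
def outputStabilizer (h : G → Noise p → 𝒴) : Set G := {g | h g 0 = h 1 0}

/-- Left-right equivariance of the output map: in law for the noisy output,
pointwise for the noiseless output. -/
structure LeftRightEquivariant [MeasurableSpace 𝒴] (h : G → Noise p → 𝒴)
    (νV : Measure (Noise p)) : Prop where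
  law : ∀ g χ : G, νV.map (h (χ * g)) = νV.map (fun v => g⁻¹ • h χ v)
  noiseless : ∀ g χ : G, h (χ * g) 0 = g⁻¹ • h χ 0

end Dynamics

section Probability

variable {G 𝒴 : Type*} [Group G] [MeasurableSpace G] {p : ℕ}

/-- The initial state, the initial estimate and the noises of a run of the system and filter:
the `W n` are i.i.d. of law `νW`, the `V n` are i.i.d. of law `νV`, and the two noise sequences and
the pair of initial values are mutually independent. -/
structure IsNoisyRun {Ω : Type*} [MeasurableSpace Ω] (P : Measure Ω)
    (νW : Measure G) (νV : Measure (Noise p)) (χ₀ χhat₀ : Ω → G)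
    (W : ℕ → Ω → G) (V : ℕ → Ω → Noise p) : Prop where
  measurable_state : Measurable χ₀
  measurable_estimate : Measurable χhat₀
  measurable_W : ∀ n, Measurable (W n)
  measurable_V : ∀ n, Measurable (V n)
  law_W : ∀ n, P.map (W n) = νW
  law_V : ∀ n, P.map (V n) = νV
  indep_W : iIndepFun W P
  indep_V : iIndepFun V P
  indep_W_V : IndepFun (fun ω n => W n ω) (fun ω n => V n ω) P
  indep_init : IndepFun (fun ω => (χ₀ ω, χhat₀ ω)) (fun ω => (fun n => W n ω, fun n => V n ω)) P

/-- `π` is a stationary distribution of the error Markov chain. -/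
def IsStationary (h : G → Noise p → 𝒴) (K : 𝒴 → G) (Υ : G)
    (νW : Measure G) (νV : Measure (Noise p)) (π : Measure G) : Prop :=
  (π.prod (νW.prod νV)).map (fun z => errorStep h K Υ z.1 z.2.1 z.2.2) = π

/-- The law `νW` on the group is isotropic: invariant under all conjugations. -/
def IsIsotropic (νW : Measure G) : Prop :=
  ∀ g : G, νW.map (fun w => g * w * g⁻¹) = νW

end Probability

/-- Total variation norm of the difference of two finite measures. -/
noncomputable def tvDist {X : Type*} [MeasurableSpace X] (μ ν : Measure X)
    [IsFiniteMeasure μ] [IsFiniteMeasure ν] : ℝ≥0∞ :=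
  (μ.toSignedMeasure - ν.toSignedMeasure).totalVariation Set.univ

end InvariantFilter

/-! The proof is a uniform Doeblin minorization for the error chain. One step is noise followed by
correction; in the reverse order (correction, then noise) the law from `y` dominates a multiple of
Haar measure on a ball around `T y`, with `T = noiselessStep`
(`smul_restrict_ball_le_noise_mul_correct`). Such a chain can follow any pseudo-orbit of `T` with
small jumps, as long as `T` is continuous along it.

Equivariance makes `S` the stabilizer of `h 1 0`, a subgroup containing `Υ`, and gives `T (s * g) =
Υ * s * Υ⁻¹ * T g` for `s ∈ S`. Small jumps inside `S` therefore accumulate; since `S` is compact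
and connected, after enough steps a pseudo-orbit from `γ` reaches every point of `S * T^[n] γ`. For
almost every `γ` the orbit approaches `S`, so some such point is near `1`, for all large `n`. A
finite net of good points and one extra jump make the number of steps uniform
(`exists_pow_ge_restrict_ball`).

Restoring the order of noise and correction (`comp_le_mul_pow_succ`) gives the hypothesis of
`doeblin`. Inputs play no role, because the law of the error evolves by a kernel free of them
(`IsNoisyRun.map_error_succ`). Under isotropy, suitable left translations commute with the kernel,
and uniqueness makes `π` invariant. -/

namespace InvariantFilter

/-! ### Doeblin's theorem by splitting off a common component. -/

section Doeblin

variable {X : Type*} [MeasurableSpace X]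

lemma tvDist_add_le (C ρ ρ' : Measure X) [IsFiniteMeasure C] [IsFiniteMeasure ρ]
    [IsFiniteMeasure ρ'] : tvDist (C + ρ) (C + ρ') ≤ ρ Set.univ + ρ' Set.univ := by
  rw [tvDist, Measure.toSignedMeasure_add, Measure.toSignedMeasure_add, add_sub_add_left_eq_sub,
    SignedMeasure.totalVariation_eq_variation]
  refine (VectorMeasure.variation_sub_le _).trans ?_
  simp

lemma eq_of_tvDist_eq_zero {μ ν : Measure X} [IsFiniteMeasure μ] [IsFiniteMeasure ν]
    (h : tvDist μ ν = 0) : μ = ν := by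
  rw [← Measure.toSignedMeasure_eq_toSignedMeasure_iff, ← sub_eq_zero]
  ext s hs
  have h1 := (μ.toSignedMeasure - ν.toSignedMeasure).enorm_le_totalVariation s
  have h2 : (μ.toSignedMeasure - ν.toSignedMeasure).totalVariation s = 0 :=
    measure_mono_null (Set.subset_univ s) h
  simpa [h2] using h1

instance isMarkovKernel_pow (κ : Kernel X X) [IsMarkovKernel κ] (n : ℕ) :
    IsMarkovKernel (κ ^ n) := by
  induction n with
  | zero => exact inferInstanceAs (IsMarkovKernel (Kernel.id : Kernel X X))
  | succ n ih =>
    rw [pow_succ']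
    exact Kernel.IsMarkovKernel.comp κ (κ ^ n)

lemma pow_succ_comp_measure (κ : Kernel X X) (n : ℕ) (μ : Measure X) :
    ⇑(κ ^ (n + 1)) ∘ₘ μ = κ ∘ₘ (⇑(κ ^ n) ∘ₘ μ) := by
  rw [Measure.comp_assoc, pow_succ']
  rfl

lemma pow_zero_comp_measure (κ : Kernel X X) (μ : Measure X) : ⇑(κ ^ 0) ∘ₘ μ = μ :=
  Measure.id_comp

/-- A kernel bounded below by `ν` splits into `ν` and a residual kernel. -/
lemma exists_residual (κ : Kernel X X) (ν : Measure X) [IsFiniteMeasure ν]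
    (hν : ∀ x, ν ≤ κ x) : ∃ R : Kernel X X, ∀ x, κ x = R x + ν := by
  refine ⟨⟨fun x => κ x - ν, ?_⟩, fun x => (Measure.sub_add_cancel_of_le (hν x)).symm⟩
  refine Measure.measurable_of_measurable_coe _ fun s hs => ?_
  simp_rw [Measure.sub_apply hs (hν _)]
  exact (κ.measurable_coe hs).sub measurable_const

lemma comp_eq_residual_add {κ R : Kernel X X} {ν : Measure X}
    (hR : ∀ x, κ x = R x + ν) (μ : Measure X) :
    κ ∘ₘ μ = R ∘ₘ μ + μ Set.univ • ν := by
  have : κ = R + Kernel.const X ν := by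
    ext1 x
    simp [hR]
  rw [this, Measure.add_comp]
  simp

/-- All measures `R x` have the same mass, so `R` contracts the mass of any measure by one fixed
factor. -/
lemma residual_comp_univ {κ R : Kernel X X} [IsMarkovKernel κ] {ν : Measure X}
    [IsFiniteMeasure ν]
    (hR : ∀ x, κ x = R x + ν) (μ : Measure X) :
    (R ∘ₘ μ) Set.univ = μ Set.univ * (1 - ν Set.univ) := by
  have h : ∀ x, R x Set.univ = 1 - ν Set.univ := fun x => by
    have : κ x Set.univ = 1 := measure_univ
    rw [hR x, Measure.add_apply] at this
    rw [← this, ENNReal.add_sub_cancel_right (measure_ne_top _ _)]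
  rw [Measure.bind_apply MeasurableSet.univ R.measurable.aemeasurable]
  simp [h, mul_comm]

lemma residual_pow_comp_univ {κ R : Kernel X X} [IsMarkovKernel κ] {ν : Measure X}
    [IsFiniteMeasure ν] (hR : ∀ x, κ x = R x + ν) (μ : Measure X) (n : ℕ) :
    (⇑(R ^ n) ∘ₘ μ) Set.univ = μ Set.univ * (1 - ν Set.univ) ^ n := by
  induction n with
  | zero => rw [pow_zero_comp_measure]; simp
  | succ n ih => rw [pow_succ_comp_measure, residual_comp_univ hR, ih, pow_succ, mul_assoc]

/-- A Markov kernel bounded below by a nonzero measure has an invariant probability measure. -/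
lemma exists_invariant_of_le (κ : Kernel X X) [IsMarkovKernel κ] (ν : Measure X)
    [IsFiniteMeasure ν] (hν : ∀ x, ν ≤ κ x) (hν0 : ν Set.univ ≠ 0) :
    ∃ π : Measure X, IsProbabilityMeasure π ∧ κ ∘ₘ π = π := by
  obtain ⟨R, hR⟩ := exists_residual κ ν hν
  have hX : Nonempty X := by
    by_contra hX
    rw [not_nonempty_iff] at hX
    exact hν0 (by simp [Measure.eq_zero_of_isEmpty ν])
  have hν1 : ν Set.univ ≤ 1 := (hν hX.some _).trans_eq measure_univ
  -- For a probability measure, invariance reads `π = R ∘ₘ π + ν`; this is its Neumann series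
  -- solution, whose mass is a geometric series.
  set π : Measure X := Measure.sum fun k : ℕ => ⇑(R ^ k) ∘ₘ ν with hπ
  have hmass : π Set.univ = 1 := by
    rw [hπ, Measure.sum_apply _ MeasurableSet.univ]
    simp_rw [residual_pow_comp_univ hR, ENNReal.tsum_mul_left, ENNReal.tsum_geometric]
    rw [ENNReal.sub_sub_cancel ENNReal.one_ne_top hν1,
      ENNReal.mul_inv_cancel hν0 (measure_ne_top _ _)]
  refine ⟨π, ⟨hmass⟩, ?_⟩
  rw [comp_eq_residual_add hR, hmass, one_smul, hπ, Measure.bind_sum _ _ R.measurable.aemeasurable]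
  ext s hs
  rw [Measure.add_apply, Measure.sum_apply _ hs, Measure.sum_apply _ hs,
    tsum_eq_zero_add' (f := fun k => (⇑(R ^ k) ∘ₘ ν) s) ENNReal.summable]
  simp_rw [pow_succ_comp_measure, pow_zero_comp_measure]
  exact add_comm _ _

/-- The two residuals have equal mass, so at each step they release the same multiple of `ν`, which
joins the common part. This is a coupling carried out on measures. -/
lemma exists_common_part {κ : Kernel X X} [IsMarkovKernel κ] {ν : Measure X}
    [IsFiniteMeasure ν] (hν : ∀ x, ν ≤ κ x) (μ μ' : Measure X)
    [IsProbabilityMeasure μ] [IsProbabilityMeasure μ'] (n : ℕ) :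
    ∃ C ρ ρ' : Measure X, ⇑(κ ^ n) ∘ₘ μ = C + ρ ∧ ⇑(κ ^ n) ∘ₘ μ' = C + ρ' ∧
      ρ Set.univ = (1 - ν Set.univ) ^ n ∧ ρ' Set.univ = (1 - ν Set.univ) ^ n := by
  obtain ⟨R, hR⟩ := exists_residual κ ν hν
  induction n with
  | zero => exact ⟨0, μ, μ', by rw [pow_zero_comp_measure, zero_add],
      by rw [pow_zero_comp_measure, zero_add], by simp, by simp⟩
  | succ n ih =>
    obtain ⟨C, ρ, ρ', h1, h2, h3, h4⟩ := ih
    refine ⟨κ ∘ₘ C + (1 - ν Set.univ) ^ n • ν, R ∘ₘ ρ, R ∘ₘ ρ', ?_, ?_, ?_, ?_⟩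
    · rw [pow_succ_comp_measure, h1, Measure.comp_add, comp_eq_residual_add hR ρ, h3, add_assoc,
        add_comm (R ∘ₘ ρ)]
    · rw [pow_succ_comp_measure, h2, Measure.comp_add, comp_eq_residual_add hR ρ', h4, add_assoc,
        add_comm (R ∘ₘ ρ')]
    · rw [residual_comp_univ hR, h3, pow_succ]
    · rw [residual_comp_univ hR, h4, pow_succ]

lemma tvDist_pow_comp_le {κ : Kernel X X} [IsMarkovKernel κ] {ν : Measure X}
    [IsFiniteMeasure ν] (hν : ∀ x, ν ≤ κ x) (μ μ' : Measure X)
    [IsProbabilityMeasure μ] [IsProbabilityMeasure μ'] (n : ℕ) :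
    tvDist (⇑(κ ^ n) ∘ₘ μ) (⇑(κ ^ n) ∘ₘ μ') ≤ 2 * (1 - ν Set.univ) ^ n := by
  obtain ⟨C, ρ, ρ', h1, h2, h3, h4⟩ := exists_common_part hν μ μ' n
  have hC : IsFiniteMeasure C :=
    isFiniteMeasure_of_le (⇑(κ ^ n) ∘ₘ μ) (h1 ▸ Measure.le_add_right le_rfl)
  have hfin : (1 - ν Set.univ) ^ n < ∞ :=
    ENNReal.pow_lt_top (tsub_le_self.trans_lt ENNReal.one_lt_top)
  have hρ : IsFiniteMeasure ρ := ⟨h3 ▸ hfin⟩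
  have hρ' : IsFiniteMeasure ρ' := ⟨h4 ▸ hfin⟩
  simp_rw [h1, h2]
  exact (tvDist_add_le C ρ ρ').trans_eq (by rw [h3, h4, two_mul])

lemma tendsto_pow_one_sub {a : ℝ≥0∞} (ha : a ≠ 0) :
    Tendsto (fun n : ℕ => 2 * (1 - a) ^ n) atTop (𝓝 0) := by
  have := ENNReal.Tendsto.const_mul (a := 2)
    (ENNReal.tendsto_pow_atTop_nhds_zero_of_lt_one
      (ENNReal.sub_lt_self ENNReal.one_ne_top one_ne_zero ha)) (Or.inr ENNReal.ofNat_ne_top)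
  simpa using this

lemma pow_comp_eq_self {κ : Kernel X X} {π : Measure X} (hπ : κ ∘ₘ π = π) (n : ℕ) :
    ⇑(κ ^ n) ∘ₘ π = π := by
  induction n with
  | zero => exact pow_zero_comp_measure κ π
  | succ n ih => rw [pow_succ_comp_measure, ih, hπ]

lemma invariant_unique_of_le {κ : Kernel X X} [IsMarkovKernel κ] {ν : Measure X}
    [IsFiniteMeasure ν] (hν : ∀ x, ν ≤ κ x) (hν0 : ν Set.univ ≠ 0) (π π' : Measure X)
    [IsProbabilityMeasure π] [IsProbabilityMeasure π'] (hπ : κ ∘ₘ π = π) (hπ' : κ ∘ₘ π' = π') :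
    π' = π := by
  refine eq_of_tvDist_eq_zero (le_antisymm ?_ zero_le)
  refine ge_of_tendsto' (tendsto_pow_one_sub hν0) fun n => ?_
  have := tvDist_pow_comp_le hν π' π n
  simpa only [pow_comp_eq_self hπ, pow_comp_eq_self hπ'] using this

/-- **Doeblin's theorem**: a Markov kernel one of whose powers is bounded below by a nonzero measure
has a unique invariant probability measure, and the chain converges to it in total variation. -/
theorem doeblin (κ : Kernel X X) [IsMarkovKernel κ] (ν : Measure X) [IsFiniteMeasure ν] {N : ℕ}
    (hN : 0 < N) (hν : ∀ x, ν ≤ (κ ^ N) x) (hν0 : ν Set.univ ≠ 0) :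
    ∃ (π : Measure X) (_ : IsProbabilityMeasure π), κ ∘ₘ π = π ∧
      (∀ π' : Measure X, IsProbabilityMeasure π' → κ ∘ₘ π' = π' → π' = π) ∧
      ∀ (μ : ℕ → Measure X) [∀ n, IsProbabilityMeasure (μ n)], (∀ n, μ (n + 1) = κ ∘ₘ μ n) →
        Tendsto (fun n => tvDist (μ n) π) atTop (𝓝 0) := by
  obtain ⟨π, hπp, hπ⟩ := exists_invariant_of_le (κ ^ N) ν hν hν0
  -- `κ ∘ₘ π` is again invariant under `κ ^ N`, because powers of `κ` commute.
  have hinv : κ ∘ₘ π = π := by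
    refine invariant_unique_of_le hν hν0 π (κ ∘ₘ π) hπ ?_
    rw [Measure.comp_assoc]; change ⇑(κ ^ N * κ) ∘ₘ π = _
    rw [← pow_succ, pow_succ_comp_measure, hπ]
  refine ⟨π, hπp, hinv, fun π' _ hπ' =>
    invariant_unique_of_le hν hν0 π π' hπ (pow_comp_eq_self hπ' N), fun μ _ hμ => ?_⟩
  have hiter : ∀ m n, μ (m + n) = ⇑(κ ^ m) ∘ₘ μ n := fun m n => by
    induction m with
    | zero => rw [pow_zero_comp_measure, zero_add]
    | succ m ih => rw [pow_succ_comp_measure, ← ih, ← hμ]; congr 1; ring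
  -- The contraction bound ignores the initial law, so the chain may be restarted from its law at
  -- time `n % N`.
  have hle : ∀ n, tvDist (μ n) π ≤ 2 * (1 - ν Set.univ) ^ (n / N) := fun n => by
    have h1 : μ n = ⇑((κ ^ N) ^ (n / N)) ∘ₘ μ (n % N) := by
      rw [← pow_mul, ← hiter, Nat.div_add_mod]
    have := tvDist_pow_comp_le hν (μ (n % N)) π (n / N)
    simp_rw [h1]
    simpa only [pow_comp_eq_self hπ] using this
  exact tendsto_of_tendsto_of_tendsto_of_le_of_le tendsto_const_nhds
    ((tendsto_pow_one_sub hν0).comp (Nat.tendsto_div_const_atTop hN.ne')) (fun _ => zero_le) hle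

end Doeblin

/-! ### Topology and Haar measure of compact groups. -/

section CompactGroup

variable {G : Type*} [Group G]

/-- A Haar measure on a compact group is right-invariant. -/
lemma isMulRightInvariant_haar [TopologicalSpace G] [IsTopologicalGroup G] [CompactSpace G]
    [MeasurableSpace G] [BorelSpace G] :
    (Measure.haar : Measure G).IsMulRightInvariant := by
  refine ⟨fun g => ?_⟩
  -- A right translate of Haar measure is still left-invariant, hence a multiple of it; comparing
  -- total masses shows that the factor is one.
  have h := Measure.isMulInvariant_eq_smul_of_compactSpace
    (Measure.map (· * g) (Measure.haar : Measure G)) Measure.haar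
  have h1 := congrArg (fun m => m Set.univ) h
  simp only [Measure.smul_apply] at h1
  rw [Measure.map_apply (measurable_mul_const g) MeasurableSet.univ, Set.preimage_univ] at h1
  have h0 : (Measure.haar : Measure G) Set.univ ≠ 0 := (Measure.measure_univ_pos.2 (NeZero.ne _)).ne'
  have ht : (Measure.haar : Measure G) Set.univ ≠ ∞ := measure_ne_top _ _
  rw [h]
  generalize Measure.haarScalarFactor (Measure.map (· * g) (Measure.haar : Measure G))
    Measure.haar = c at h1 ⊢
  have : (c : ℝ≥0∞) = 1 := by
    refine (ENNReal.mul_left_inj h0 ht).1 ?_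
    rw [one_mul]
    exact h1.symm
  rw [ENNReal.coe_eq_one.1 this, one_smul]

/-- Every conjugation fixes `1`; compactness, through the tube lemma, makes the neighbourhood
uniform in `g`. -/
lemma exists_nhds_one_conj_mem [TopologicalSpace G] [IsTopologicalGroup G] [CompactSpace G]
    {V : Set G} (hV : IsOpen V) (h1 : (1 : G) ∈ V) :
    ∃ U : Set G, IsOpen U ∧ (1 : G) ∈ U ∧ ∀ g, ∀ u ∈ U, g * u * g⁻¹ ∈ V := by
  have ho : IsOpen {z : G × G | z.1 * z.2 * z.1⁻¹ ∈ V} := hV.preimage (by fun_prop)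
  obtain ⟨A, U, -, hU, hA, h1U, hAU⟩ := generalized_tube_lemma (isCompact_univ (X := G))
    (isCompact_singleton (x := (1 : G))) ho (by rintro ⟨g, u⟩ ⟨-, rfl⟩; simpa using h1)
  exact ⟨U, hU, h1U rfl, fun g u hu => hAU (Set.mk_mem_prod (hA trivial) hu)⟩

open scoped Pointwise in
/-- A neighbourhood of the identity in a compact connected group has a power that is everything. -/
lemma exists_pow_eq_univ [TopologicalSpace G] [IsTopologicalGroup G] [CompactSpace G]
    [PreconnectedSpace G] {U : Set G} (hU : IsOpen U) (h1 : (1 : G) ∈ U) :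
    ∃ m, ∀ n, m ≤ n → U ^ n = Set.univ := by
  have hmono : Monotone fun n : ℕ => U ^ n := fun a b hab =>
    Set.pow_subset_pow_right h1 hab
  have hopen : ∀ n, IsOpen (U ^ (n + 1)) := fun n => by
    rw [pow_succ]; exact hU.mul_left
  -- The union is closed without symmetry of `U`: near a limit point `x` lies some `y` of the union
  -- with `x * y⁻¹ ∈ U`, and then `x` lies in the next power. Exponents start at one since `U ^ 0`
  -- need not be open.
  have hclopen : IsClopen (⋃ n, U ^ (n + 1)) := by
    refine ⟨?_, isOpen_iUnion hopen⟩
    refine isClosed_of_closure_subset fun x hx => ?_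
    have hn : {y | x * y⁻¹ ∈ U} ∈ 𝓝 x :=
      (hU.preimage (by fun_prop : Continuous fun y => x * y⁻¹)).mem_nhds (by simpa using h1)
    obtain ⟨y, hy, hyU⟩ := mem_closure_iff_nhds.1 hx _ hn
    obtain ⟨n, hn⟩ := Set.mem_iUnion.1 hyU
    refine Set.mem_iUnion.2 ⟨n + 1, ?_⟩
    rw [pow_succ']
    exact Set.mem_mul.2 ⟨x * y⁻¹, hy, y, hn, by group⟩
  have huniv := hclopen.eq_univ ⟨1, Set.mem_iUnion.2 ⟨0, by simpa using h1⟩⟩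
  obtain ⟨m, hm⟩ := isCompact_univ.elim_directed_cover (fun n => U ^ (n + 1)) hopen huniv.ge
    (directed_of_isDirected_le fun a b hab => hmono (Nat.succ_le_succ hab))
  exact ⟨m + 1, fun n hn => Set.eq_univ_of_univ_subset (hm.trans (hmono hn))⟩

/-- In a compact space, if the images tend to a point then the points tend to its fibre. -/
lemma eventually_mem_of_tendsto_apply {X Y : Type*} [TopologicalSpace X] [CompactSpace X]
    [TopologicalSpace Y] [T2Space Y] {f : X → Y} (hf : Continuous f) {x : ℕ → X} {y : Y}
    (hx : Tendsto (fun n => f (x n)) atTop (𝓝 y)) {O : Set X} (hO : IsOpen O)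
    (hyO : ∀ z, f z = y → z ∈ O) : ∀ᶠ n in atTop, x n ∈ O := by
  have hc : IsClosed (f '' Oᶜ) := hf.isClosedMap _ hO.isClosed_compl
  have hy : y ∈ (f '' Oᶜ)ᶜ := by
    rintro ⟨z, hz, rfl⟩
    exact hz (hyO z rfl)
  filter_upwards [hx (hc.isOpen_compl.mem_nhds hy)] with n hn
  by_contra hxn
  exact hn ⟨_, hxn, rfl⟩

end CompactGroup

/-! ### Maps equivariant under a subgroup, up to conjugation by `t`. -/

section Equivariant

variable {G : Type*} [Group G] {T : G → G} {H : Subgroup G} {t : G}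

/-- Writing the offset at time `n` as a conjugate by `t ^ n` leaves the coordinate `s` unchanged
when `T` is applied. -/
lemma iterate_equivariant (hTH : ∀ s ∈ H, ∀ g, T (s * g) = t * s * t⁻¹ * T g) (n : ℕ) (g s : G)
    (hs : s ∈ H) (ht : t ∈ H) : T (t ^ n * s * (t ^ n)⁻¹ * g)
      = t ^ (n + 1) * s * (t ^ (n + 1))⁻¹ * T g := by
  rw [hTH _ (H.mul_mem (H.mul_mem (H.pow_mem ht n) hs) (H.inv_mem (H.pow_mem ht n)))]
  simp only [pow_succ', mul_inv_rev, mul_assoc]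

lemma continuousAt_mul_left_of_equivariant [TopologicalSpace G] [IsTopologicalGroup G]
    (hTH : ∀ s ∈ H, ∀ g, T (s * g) = t * s * t⁻¹ * T g)
    {s g : G} (hs : s ∈ H) (hg : ContinuousAt T g) : ContinuousAt T (s * g) := by
  have h1 : T = fun x => t * s * t⁻¹ * T (s⁻¹ * x) := by
    funext x
    rw [← hTH s hs, mul_inv_cancel_left]
  rw [h1]
  refine continuousAt_const.mul (ContinuousAt.comp ?_ (by fun_prop))
  rwa [inv_mul_cancel_left]

end Equivariant

/-! ### Accessibility by pseudo-orbits and a uniform minorization. -/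

section Reaches

variable {G : Type*} [Group G] [MetricSpace G] [IsTopologicalGroup G] [CompactSpace G]
  [MeasurableSpace G] [BorelSpace G]

/-- From every point near `x`, the `n`-step transition law dominates a multiple of the Haar measure
near `y`. -/
def Reaches (P : Kernel G G) (n : ℕ) (x y : G) : Prop :=
  ∃ δ > 0, ∃ c : ℝ≥0∞, c ≠ 0 ∧ ∀ z ∈ Metric.ball x δ,
    c • (Measure.haar : Measure G).restrict (Metric.ball y δ) ≤ (P ^ n) z

lemma haar_ball_ne_zero (x : G) {r : ℝ} (hr : 0 < r) :
    (Measure.haar : Measure G) (Metric.ball x r) ≠ 0 :=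
  (Metric.measure_ball_pos _ _ hr).ne'

/-- Chapman–Kolmogorov, with the intermediate point integrated only over the ball of radius `δ'`,
where both bounds hold. -/
lemma smul_restrict_ball_le_pow_add {P : Kernel G G} {m n : ℕ} {x y z : G} {δ δ' δ'' : ℝ}
    {c c' : ℝ≥0∞} (hm : c • (Measure.haar : Measure G).restrict (Metric.ball y δ) ≤ (P ^ m) x)
    (hn : ∀ w ∈ Metric.ball y δ',
      c' • (Measure.haar : Measure G).restrict (Metric.ball z δ'') ≤ (P ^ n) w) (hδ : δ' ≤ δ) :
    (c * Measure.haar (Metric.ball y δ') * c') •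
      (Measure.haar : Measure G).restrict (Metric.ball z δ'') ≤ (P ^ (m + n)) x := by
  refine Measure.le_iff.2 fun s hs => ?_
  rw [Kernel.pow_add_apply_eq_lintegral _ _ _ _ hs]
  have hsub : Metric.ball y δ' ⊆ Metric.ball y δ := Metric.ball_subset_ball hδ
  calc (c * Measure.haar (Metric.ball y δ') * c') •
        (Measure.haar : Measure G).restrict (Metric.ball z δ'') s
      = c * ∫⁻ _ in Metric.ball y δ',
          c' * (Measure.haar : Measure G).restrict (Metric.ball z δ'') s ∂Measure.haar := by
        rw [setLIntegral_const, smul_eq_mul]; ring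
    _ ≤ c * ∫⁻ w in Metric.ball y δ', (P ^ n) w s ∂Measure.haar := by
        gcongr 1
        exact setLIntegral_mono' Metric.isOpen_ball.measurableSet fun w hw => hn w hw s
    _ ≤ c * ∫⁻ w in Metric.ball y δ, (P ^ n) w s ∂Measure.haar := by
        gcongr 1
        exact lintegral_mono_set hsub
    _ = ∫⁻ w, (P ^ n) w s ∂(c • (Measure.haar : Measure G).restrict (Metric.ball y δ)) := by
        rw [lintegral_smul_measure, smul_eq_mul]
    _ ≤ _ := lintegral_mono' hm le_rfl

lemma Reaches.trans {P : Kernel G G} {m n : ℕ} {x y z : G} (hm : Reaches P m x y)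
    (hn : Reaches P n y z) : Reaches P (m + n) x z := by
  obtain ⟨δ, hδ, c, hc, h⟩ := hm
  obtain ⟨δ', hδ', c', hc', h'⟩ := hn
  have hpos : 0 < min δ δ' := lt_min hδ hδ'
  refine ⟨min δ δ', hpos, c * Measure.haar (Metric.ball y (min δ δ')) * c',
    mul_ne_zero (mul_ne_zero hc (haar_ball_ne_zero y hpos)) hc', fun w hw => ?_⟩
  refine (?_ : _ ≤ _).trans (smul_restrict_ball_le_pow_add (z := z) (δ'' := δ')
    (h w (Metric.ball_subset_ball (min_le_left _ _) hw))
    (fun v hv => h' v (Metric.ball_subset_ball (min_le_right _ _) hv)) (min_le_left _ _))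
  gcongr
  exact min_le_right _ _

lemma reaches_one {P : Kernel G G} {T : G → G} {r : ℝ} {c : ℝ≥0∞} (hc : c ≠ 0)
    (hP : ∀ y, c • (Measure.haar : Measure G).restrict (Metric.ball (T y) r) ≤ P y)
    {x y : G} (hT : ContinuousAt T x) (hy : dist y (T x) < r) : Reaches P 1 x y := by
  -- The slack `r - dist y (T x)` is shared equally between the variation of `T` near `x` and the
  -- radius of the target ball around `y`.
  have h1 : ∀ᶠ z in 𝓝 x, dist (T z) (T x) < (r - dist y (T x)) / 2 :=
    Metric.tendsto_nhds.1 hT _ (by linarith)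
  obtain ⟨δ, hδ, h⟩ := Metric.eventually_nhds_iff_ball.1 h1
  refine ⟨min δ ((r - dist y (T x)) / 2), lt_min hδ (by linarith), c, hc, fun z hz => ?_⟩
  rw [pow_one]
  refine le_trans ?_ (hP z)
  gcongr
  intro w hw
  have hw' := Metric.mem_ball.1 (Metric.ball_subset_ball (min_le_right _ _) hw)
  have hz' := h z (Metric.ball_subset_ball (min_le_left _ _) hz)
  rw [Metric.mem_ball]
  linarith [dist_triangle w y (T z), dist_triangle y (T x) (T z), dist_comm (T x) (T z)]

variable {T : G → G} {H : Subgroup G} {t : G}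

open scoped Pointwise in
-- Each step allows a jump by any element of the ball around `1`. Jumping by a `t`-power conjugate
-- of `u ∈ U` multiplies the coordinate `b` by `u`, so the available coordinates fill successive
-- powers of `U`.
lemma reaches_translate (hd : ∀ x y z : G, dist (x * z) (y * z) = dist x y)
    {P : Kernel G G} {r : ℝ} {c : ℝ≥0∞} (hc : c ≠ 0)
    (hP : ∀ y, c • (Measure.haar : Measure G).restrict (Metric.ball (T y) r) ≤ P y)
    (ht : t ∈ H) (hTH : ∀ s ∈ H, ∀ g, T (s * g) = t * s * t⁻¹ * T g)
    {U : Set H} (hU : ∀ g : G, ∀ u ∈ U, g * u * g⁻¹ ∈ Metric.ball (1 : G) r)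
    {γ : G} (hγ : ∀ n, ContinuousAt T (T^[n] γ)) (n : ℕ) :
    ∀ b ∈ U ^ (n + 1),
      Reaches P (n + 1) γ (t ^ (n + 1) * b * (t ^ (n + 1))⁻¹ * T^[n + 1] γ) := by
  induction n with
  | zero =>
    intro b hb
    refine reaches_one hc hP (hγ 0) ?_
    simp only [zero_add, Function.iterate_one] at hb ⊢
    have := hd (t ^ 1 * b * (t ^ 1)⁻¹) 1 (T γ)
    rw [one_mul] at this
    rw [this]
    exact hU _ b (by simpa using hb)
  | succ n ih =>
    intro b hb
    rw [pow_succ'] at hb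
    obtain ⟨u, hu, b', hb', rfl⟩ := Set.mem_mul.1 hb
    refine (ih b' hb').trans (reaches_one hc hP ?_ ?_)
    · exact continuousAt_mul_left_of_equivariant hTH
        (H.mul_mem (H.mul_mem (H.pow_mem ht _) b'.2) (H.inv_mem (H.pow_mem ht _))) (hγ _)
    -- Right-invariance cancels the orbit point and then the offset of `b'`, leaving the distance to
    -- `1` of a conjugate of `u`.
    · rw [iterate_equivariant hTH _ _ _ b'.2 ht, ← Function.iterate_succ_apply' T, hd,
        ← hd _ _ (t ^ (n + 1 + 1) * b' * (t ^ (n + 1 + 1))⁻¹)⁻¹, mul_inv_cancel]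
      have := hU (t ^ (n + 1 + 1)) u hu
      rw [Metric.mem_ball] at this
      convert this using 2
      simp only [Subgroup.coe_mul]
      group

/-- A chain that dominates Haar measure near the images of a map `T`, equivariant under a connected
subgroup which attracts almost all orbits of `T`, dominates Haar measure near the identity after a
number of steps which does not depend on the starting point. -/
theorem exists_pow_ge_restrict_ball (hd : ∀ x y z : G, dist (x * z) (y * z) = dist x y)
    {P : Kernel G G} {r : ℝ} (hr : 0 < r) {c : ℝ≥0∞} (hc : c ≠ 0)
    (hP : ∀ y, c • (Measure.haar : Measure G).restrict (Metric.ball (T y) r) ≤ P y)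
    (hconn : IsConnected (H : Set G)) (hclosed : IsClosed (H : Set G))
    (ht : t ∈ H) (hTH : ∀ s ∈ H, ∀ g, T (s * g) = t * s * t⁻¹ * T g)
    (hcont : ∀ᵐ γ : G ∂Measure.haar, ∀ n, ContinuousAt T (T^[n] γ))
    (hconv : ∀ᵐ γ : G ∂Measure.haar, ∀ᶠ n in atTop, ∃ s ∈ H, dist 1 (s * T^[n] γ) < r) :
    ∃ N : ℕ, ∃ δ > 0, ∃ c' : ℝ≥0∞, c' ≠ 0 ∧ ∀ y,
      c' • (Measure.haar : Measure G).restrict (Metric.ball 1 δ) ≤ (P ^ N) y := by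
  have : CompactSpace H := isCompact_iff_compactSpace.1 hclosed.isCompact
  have : ConnectedSpace H := isConnected_iff_connectedSpace.1 hconn
  obtain ⟨U, hUo, hU1, hU⟩ := exists_nhds_one_conj_mem
    (Metric.isOpen_ball (x := (1 : G)) (ε := r)) (Metric.mem_ball_self hr)
  obtain ⟨m, hm⟩ := exists_pow_eq_univ (hUo.preimage continuous_subtype_val : IsOpen
    ((↑) ⁻¹' U : Set H)) (by simpa using hU1)
  have hgood : ∀ γ : G, (∀ n, ContinuousAt T (T^[n] γ)) →
      (∀ᶠ n in atTop, ∃ s ∈ H, dist 1 (s * T^[n] γ) < r) →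
      ∀ᶠ n in atTop, Reaches P n γ 1 := fun γ h1 h2 => by
    have h2' := h2.and (eventually_ge_atTop (m + 2))
    filter_upwards [h2'] with n ⟨⟨s, hs, hsn⟩, hn⟩
    obtain ⟨n, rfl⟩ : ∃ k, n = k + 1 + 1 := ⟨n - 2, by omega⟩
    -- This coordinate is chosen so that after the last application of `T` the offset is exactly
    -- `s`. It is available because the power of `U` is already all of `H`.
    have hb : (t ^ (n + 1 + 1))⁻¹ * s * (t ^ (n + 1 + 1)) ∈ H :=
      H.mul_mem (H.mul_mem (H.inv_mem (H.pow_mem ht _)) hs) (H.pow_mem ht _)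
    have hR := reaches_translate (U := ((↑) ⁻¹' U : Set H)) hd hc hP ht hTH
      (fun g u hu => hU g u (Set.mem_preimage.1 hu)) h1 n ⟨_, hb⟩ (by rw [hm _ (by omega)]; trivial)
    refine hR.trans (reaches_one hc hP (continuousAt_mul_left_of_equivariant hTH
      (H.mul_mem (H.mul_mem (H.pow_mem ht _) hb) (H.inv_mem (H.pow_mem ht _))) (h1 _)) ?_)
    rw [iterate_equivariant hTH _ _ _ hb ht, ← Function.iterate_succ_apply' T]
    convert hsn using 2
    group
  have hdense : Dense {γ : G | (∀ n, ContinuousAt T (T^[n] γ)) ∧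
      ∀ᶠ n in atTop, ∃ s ∈ H, dist 1 (s * T^[n] γ) < r} :=
    Measure.dense_of_ae (μ := Measure.haar) (hcont.and hconv)
  obtain ⟨F, hF, hFc⟩ : ∃ F : Finset G, (∀ γ ∈ F, ∀ᶠ n in atTop, Reaches P n γ 1) ∧
      ∀ g : G, ∃ γ ∈ F, dist γ g < r / 2 := by
    obtain ⟨F, hFs, hF, hFc⟩ := isCompact_univ.elim_finite_subcover_image
      (b := {γ : G | (∀ n, ContinuousAt T (T^[n] γ)) ∧
        ∀ᶠ n in atTop, ∃ s ∈ H, dist 1 (s * T^[n] γ) < r}) (c := fun γ => Metric.ball γ (r / 2))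
      (fun _ _ => Metric.isOpen_ball) (fun g _ => by
        obtain ⟨γ, hγ, hdist⟩ := Metric.dense_iff.1 hdense g (r / 2) (by linarith)
        exact Set.mem_biUnion hdist (by rwa [Metric.mem_ball, dist_comm] at hγ))
    refine ⟨hF.toFinset, fun γ hγ => ?_, fun g => ?_⟩
    · have := hFs ((Set.Finite.mem_toFinset hF).1 hγ)
      exact hgood γ this.1 this.2
    · obtain ⟨γ, hγ, hg⟩ := Set.mem_iUnion₂.1 (hFc (Set.mem_univ g))
      exact ⟨γ, hF.mem_toFinset.2 hγ, by rwa [Metric.mem_ball, dist_comm] at hg⟩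
  -- Each point of the finite net reaches `1` at all large times, hence all of them do at a common
  -- time.
  obtain ⟨N, hN⟩ := ((Filter.eventually_all_finset F).2 hF).exists
  choose! δ hδ a ha hR using hN
  have hFn : F.Nonempty := (hFc 1).imp fun γ hγ => hγ.1
  refine ⟨1 + N, F.inf' hFn δ, (Finset.lt_inf'_iff hFn).2 hδ,
    F.inf' hFn fun γ => c * Measure.haar (Metric.ball γ (min (δ γ) (r / 2))) * a γ, ?_, ?_⟩
  · refine ((Finset.lt_inf'_iff hFn).2 fun γ hγ => pos_iff_ne_zero.2 ?_).ne'
    exact mul_ne_zero (mul_ne_zero hc (haar_ball_ne_zero _ (lt_min (hδ γ hγ) (by linarith))))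
      (ha γ hγ)
  · intro y
    -- The first step jumps from `y` to a neighbourhood of a net point close to `T y`. Continuity of
    -- `T` at `y` is not needed, as `hP` holds at every point.
    obtain ⟨γ, hγ, hdist⟩ := hFc (T y)
    have h1 : c • (Measure.haar : Measure G).restrict (Metric.ball γ (r / 2)) ≤ (P ^ 1) y := by
      rw [pow_one]
      refine le_trans ?_ (hP y)
      gcongr
      exact Metric.ball_subset_ball' (by linarith)
    refine le_trans ?_ (smul_restrict_ball_le_pow_add (z := 1) (δ'' := δ γ) h1 (fun w hw =>
      hR γ hγ w (Metric.ball_subset_ball (min_le_left _ (r / 2)) hw)) (min_le_right _ _))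
    gcongr
    · exact Finset.inf'_le _ hγ
    · exact Finset.inf'_le _ hγ

end Reaches

/-! ### Kernels given by random maps. -/

section RandomMap

variable {X Y Z : Type*} [MeasurableSpace X] [MeasurableSpace Y] [MeasurableSpace Z]

/-- The transition kernel `x ↦ law of f x y` with `y` of law `ν`. -/
noncomputable def randomMap (ν : Measure Y) [SFinite ν] (f : X → Y → Z)
    (hf : Measurable (Function.uncurry f)) : Kernel X Z where
  toFun x := ν.map (f x)
  measurable' := by
    refine Measure.measurable_of_measurable_coe _ fun s hs => ?_
    simp_rw [Measure.map_apply hf.of_uncurry_left hs]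
    exact measurable_measure_prodMk_left (hf hs)

lemma randomMap_apply (ν : Measure Y) [SFinite ν] (f : X → Y → Z)
    (hf : Measurable (Function.uncurry f)) (x : X) : randomMap ν f hf x = ν.map (f x) := rfl

instance (ν : Measure Y) [IsProbabilityMeasure ν] (f : X → Y → Z)
    (hf : Measurable (Function.uncurry f)) : IsMarkovKernel (randomMap ν f hf) :=
  ⟨fun _ => Measure.isProbabilityMeasure_map hf.of_uncurry_left.aemeasurable⟩

lemma randomMap_comp_measure (ν : Measure Y) [SFinite ν] (f : X → Y → Z)
    (hf : Measurable (Function.uncurry f)) (μ : Measure X) :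
    randomMap ν f hf ∘ₘ μ = (μ.prod ν).map (Function.uncurry f) := by
  ext s hs
  rw [Measure.bind_apply hs (Kernel.measurable _).aemeasurable, Measure.map_apply hf hs,
    Measure.prod_apply (hf hs)]
  refine lintegral_congr fun x => ?_
  rw [randomMap_apply, Measure.map_apply hf.of_uncurry_left hs]
  rfl

/-- Iterates of `κ * η` dominate a fixed measure as soon as those of `η * κ` do. -/
lemma comp_le_mul_pow_succ (κ η : Kernel X X) [IsMarkovKernel η] {m : Measure X} {N : ℕ}
    (hm : ∀ y, m ≤ ((η * κ) ^ N) y) (x : X) : κ ∘ₘ m ≤ ((κ * η) ^ (N + 1)) x := by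
  have hpow : ∀ n : ℕ, (κ * η) ^ (n + 1) = κ * (η * κ) ^ n * η := fun n => by
    induction n with
    | zero => simp
    | succ n ih => rw [pow_succ (κ * η), ih, pow_succ (η * κ)]; simp only [mul_assoc]
  rw [hpow]
  refine Measure.le_iff.2 fun s hs => ?_
  change _ ≤ ((κ * (η * κ) ^ N) ∘ₖ η) x s
  rw [Kernel.comp_apply' _ _ _ hs]
  calc (κ ∘ₘ m) s = ∫⁻ _, (κ ∘ₘ m) s ∂η x := by simp
    _ ≤ _ := lintegral_mono fun y => by
        change _ ≤ (κ ∘ₖ ((η * κ) ^ N : Kernel X X)) y s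
        rw [Kernel.comp_apply' _ _ _ hs, Measure.bind_apply hs κ.measurable.aemeasurable]
        exact lintegral_mono' (hm y) le_rfl

lemma measurable_uncurry_mul_swap {G : Type*} [Group G] [MeasurableSpace G] [MeasurableMul₂ G] :
    Measurable (Function.uncurry fun x w : G => w * x) :=
  measurable_snd.mul measurable_fst

end RandomMap

/-! ### The error kernel and the noiseless map. -/

section ErrorChain

variable {G 𝒴 : Type*} [Group G] {p : ℕ} {h : G → Noise p → 𝒴} {K : 𝒴 → G}

/-- One step of the noiseless error. -/
def noiselessStep (h : G → Noise p → 𝒴) (K : 𝒴 → G) (Υ y : G) : G :=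
  correct h K (Υ * y * Υ⁻¹) 0

lemma noiseless_eq_iterate (Υ γ : G) (n : ℕ) :
    noiseless h K Υ γ n = (noiselessStep h K Υ)^[n] γ := by
  induction n with
  | zero => rfl
  | succ n ih =>
    rw [Function.iterate_succ_apply', ← ih]
    rfl

section

variable [MulAction G 𝒴] [MeasurableSpace 𝒴] {νV : Measure (Noise p)}

lemma outputStabilizer_eq (hequiv : LeftRightEquivariant h νV) :
    outputStabilizer h = (MulAction.stabilizer G (h 1 0) : Set G) := by
  ext g
  have := hequiv.noiseless g 1
  rw [one_mul] at this
  rw [outputStabilizer, Set.mem_ofPred_eq, this, inv_smul_eq_iff, SetLike.mem_coe,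
    MulAction.mem_stabilizer_iff, eq_comm]

/-- For `s'` in the stabilizer, `h (s' * x) 0 = x⁻¹ • h s' 0 = x⁻¹ • h 1 0 = h x 0`: the gain does
not see the factor `s'`. Here `s' = Υ * s * Υ⁻¹`, and `Υ` itself is in the stabilizer. -/
lemma noiselessStep_mul (hequiv : LeftRightEquivariant h νV) (Υ : G) {s : G}
    (hΥ : h Υ 0 = h 1 0) (hs : s ∈ MulAction.stabilizer G (h 1 0)) (g : G) :
    noiselessStep h K Υ (s * g) = Υ * s * Υ⁻¹ * noiselessStep h K Υ g := by
  have hst : Υ * s * Υ⁻¹ ∈ MulAction.stabilizer G (h 1 0) := by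
    have : Υ ∈ MulAction.stabilizer G (h 1 0) := by
      rw [← SetLike.mem_coe, ← outputStabilizer_eq hequiv]
      exact hΥ
    exact Subgroup.mul_mem _ (Subgroup.mul_mem _ this hs) (Subgroup.inv_mem _ this)
  rw [← SetLike.mem_coe, ← outputStabilizer_eq hequiv] at hst
  have h1 : Υ * (s * g) * Υ⁻¹ = Υ * s * Υ⁻¹ * (Υ * g * Υ⁻¹) := by group
  have h2 : h (Υ * s * Υ⁻¹ * (Υ * g * Υ⁻¹)) 0 = h (Υ * g * Υ⁻¹) 0 := by
    rw [hequiv.noiseless, show h (Υ * s * Υ⁻¹) 0 = h 1 0 from hst, ← hequiv.noiseless, one_mul]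
  rw [noiselessStep, noiselessStep, correct, correct, h1, h2, mul_assoc]

end

lemma continuousAt_noiselessStep [TopologicalSpace G] [IsTopologicalGroup G] {Υ γ : G} {n : ℕ}
    (hK : ContinuousAt (fun g => K (h g 0)) (noiselessPred h K Υ γ n)) :
    ContinuousAt (noiselessStep h K Υ) ((noiselessStep h K Υ)^[n] γ) := by
  rw [noiselessPred, noiseless_eq_iterate] at hK
  have hc : Continuous fun y : G => Υ * y * Υ⁻¹ := by fun_prop
  exact hc.continuousAt.mul (ContinuousAt.comp (f := fun y : G => Υ * y * Υ⁻¹) hK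
    hc.continuousAt).inv

/-- The points with a stabilizer translate close to `1` form an open set containing the stabilizer,
which is the fibre of the noiseless output over `h 1 0`. -/
lemma eventually_dist_noiseless_lt [MulAction G 𝒴] [MetricSpace G] [IsTopologicalGroup G] [CompactSpace G]
    [TopologicalSpace 𝒴] [T2Space 𝒴] [MeasurableSpace 𝒴] {νV : Measure (Noise p)}
    (hequiv : LeftRightEquivariant h νV)
    (hh0 : Continuous fun g => h g 0) {Υ γ : G}
    (hγ : Tendsto (fun n => h (noiseless h K Υ γ n) 0) atTop (𝓝 (h 1 0))) {r : ℝ} (hr : 0 < r) :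
    ∀ᶠ n in atTop, ∃ s ∈ MulAction.stabilizer G (h 1 0),
      dist 1 (s * (noiselessStep h K Υ)^[n] γ) < r := by
  simp_rw [noiseless_eq_iterate] at hγ
  refine eventually_mem_of_tendsto_apply hh0 hγ
    (O := {g | ∃ s ∈ MulAction.stabilizer G (h 1 0), dist 1 (s * g) < r}) ?_ fun z hz => ?_
  · have : {g | ∃ s ∈ MulAction.stabilizer G (h 1 0), dist 1 (s * g) < r} =
        ⋃ s ∈ MulAction.stabilizer G (h 1 0), {g : G | dist 1 (s * g) < r} := by
      ext g; simp
    rw [this]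
    exact isOpen_biUnion fun s _ => isOpen_lt (by fun_prop) continuous_const
  · have hz' : z ∈ outputStabilizer h := hz
    rw [outputStabilizer_eq hequiv] at hz'
    exact ⟨z⁻¹, Subgroup.inv_mem _ hz', by simpa using hr⟩

variable [MeasurableSpace G] [MeasurableMul₂ G] [MeasurableInv G] [MeasurableSpace 𝒴]

lemma measurable_correct (hh : Measurable (Function.uncurry h)) (hK : Measurable K) :
    Measurable (Function.uncurry (correct h K)) :=
  measurable_fst.mul (hK.comp hh).inv

lemma measurable_errorStep (hh : Measurable (Function.uncurry h)) (hK : Measurable K) (Υ : G) :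
    Measurable (Function.uncurry fun (x : G) (z : G × Noise p) => errorStep h K Υ x z.1 z.2) :=
  (measurable_correct hh hK).comp (f := fun z : G × G × Noise p =>
    (Υ * z.2.1 * z.1 * Υ⁻¹, z.2.2)) (by fun_prop)

lemma measurable_conj_correct (hh : Measurable (Function.uncurry h)) (hK : Measurable K) (Υ : G) :
    Measurable (Function.uncurry fun (y : G) (v : Noise p) => correct h K (Υ * y * Υ⁻¹) v) :=
  (measurable_correct hh hK).comp (f := fun z : G × Noise p => (Υ * z.1 * Υ⁻¹, z.2)) (by fun_prop)

/-- Left multiplication by the process noise. -/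
noncomputable def noiseKernel (νW : Measure G) [SFinite νW] : Kernel G G :=
  randomMap νW (fun x w => w * x) measurable_uncurry_mul_swap

/-- Prediction followed by noisy correction. -/
noncomputable def correctKernel (νV : Measure (Noise p)) [SFinite νV]
    (hh : Measurable (Function.uncurry h)) (hK : Measurable K) (Υ : G) : Kernel G G :=
  randomMap νV (fun y v => correct h K (Υ * y * Υ⁻¹) v) (measurable_conj_correct hh hK Υ)

/-- Transition kernel of the error Markov chain. -/
noncomputable def errorKernel (νW : Measure G) [SFinite νW] (νV : Measure (Noise p)) [SFinite νV]
    (hh : Measurable (Function.uncurry h)) (hK : Measurable K) (Υ : G) : Kernel G G :=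
  randomMap (νW.prod νV) (fun x z => errorStep h K Υ x z.1 z.2) (measurable_errorStep hh hK Υ)

instance (νW : Measure G) [IsProbabilityMeasure νW] : IsMarkovKernel (noiseKernel νW) := by
  unfold noiseKernel; infer_instance

instance (νV : Measure (Noise p)) [IsProbabilityMeasure νV]
    (hh : Measurable (Function.uncurry h)) (hK : Measurable K) (Υ : G) :
    IsMarkovKernel (correctKernel νV hh hK Υ) := by
  unfold correctKernel; infer_instance

instance (νW : Measure G) [IsProbabilityMeasure νW] (νV : Measure (Noise p))
    [IsProbabilityMeasure νV] (hh : Measurable (Function.uncurry h)) (hK : Measurable K) (Υ : G) :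
    IsMarkovKernel (errorKernel νW νV hh hK Υ) := by
  unfold errorKernel; infer_instance

lemma isStationary_iff (νW : Measure G) [SFinite νW] (νV : Measure (Noise p)) [SFinite νV]
    (hh : Measurable (Function.uncurry h)) (hK : Measurable K) (Υ : G) (π : Measure G) :
    IsStationary h K Υ νW νV π ↔ errorKernel νW νV hh hK Υ ∘ₘ π = π := by
  rw [errorKernel, randomMap_comp_measure]
  rfl

lemma errorKernel_apply' (νW : Measure G) [SFinite νW] (νV : Measure (Noise p)) [SFinite νV]
    (hh : Measurable (Function.uncurry h)) (hK : Measurable K) (Υ x : G) {s : Set G}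
    (hs : MeasurableSet s) :
    errorKernel νW νV hh hK Υ x s
      = ∫⁻ w, νV.map (correct h K (Υ * w * x * Υ⁻¹)) s ∂νW := by
  have hm := (measurable_errorStep hh hK Υ).of_uncurry_left (x := x)
  rw [errorKernel, randomMap_apply, Measure.map_apply hm hs, Measure.prod_apply (hm hs)]
  refine lintegral_congr fun w => ?_
  rw [Measure.map_apply (measurable_correct hh hK).of_uncurry_left hs]
  rfl

lemma errorKernel_eq_mul (νW : Measure G) [SFinite νW] (νV : Measure (Noise p)) [SFinite νV]
    (hh : Measurable (Function.uncurry h)) (hK : Measurable K) (Υ : G) :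
    errorKernel νW νV hh hK Υ = correctKernel νV hh hK Υ * noiseKernel νW := by
  ext x s hs
  change _ = (correctKernel νV hh hK Υ ∘ₖ noiseKernel νW) x s
  rw [errorKernel_apply' νW νV hh hK Υ x hs, Kernel.comp_apply' _ _ _ hs, noiseKernel,
    randomMap_apply, lintegral_map (Kernel.measurable_coe _ hs) (measurable_mul_const x)]
  refine lintegral_congr fun w => ?_
  rw [correctKernel, randomMap_apply]
  simp only [mul_assoc]

end ErrorChain

/-! ### One-step lower bound for correction followed by noise. -/

section Diffusivity

variable {G 𝒴 : Type*} [Group G] [MetricSpace G] [IsTopologicalGroup G] [CompactSpace G]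
  [MeasurableSpace G] [BorelSpace G] [MeasurableSpace 𝒴] {p : ℕ}
  {h : G → Noise p → 𝒴} {K : 𝒴 → G}

/-- The correction lands in `D` with probability at least `ε'`. Two points of `D` are less than `α`
apart, so right translation by the inverse of the landing point carries `s ∩ D` into the ball where
`νW` dominates Haar measure, without changing its Haar measure. -/
lemma smul_restrict_ball_le_noise_mul_correct (hd : ∀ x y z : G, dist (x * z) (y * z) = dist x y)
    (νW : Measure G) [IsProbabilityMeasure νW] (νV : Measure (Noise p)) [IsProbabilityMeasure νV]
    (hh : Measurable (Function.uncurry h)) (hK : Measurable K) (Υ : G) {α ε ε' : ℝ}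
    (hdiff : ∀ U : Set G, MeasurableSet U → U ⊆ Metric.ball 1 α →
      ENNReal.ofReal ε * Measure.haar U ≤ νW U)
    (hout : ∀ g : G, ε' < νV.real
      {v | correct h K g v ∈ Metric.ball (correct h K g 0) (α / 2)}) (y : G) :
    (ENNReal.ofReal ε * ENNReal.ofReal ε') •
      (Measure.haar : Measure G).restrict (Metric.ball (noiselessStep h K Υ y) (α / 2))
      ≤ (noiseKernel νW * correctKernel νV hh hK Υ) y := by
  have := isMulRightInvariant_haar (G := G)
  set D := Metric.ball (noiselessStep h K Υ y) (α / 2) with hD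
  have hDm : MeasurableSet D := Metric.isOpen_ball.measurableSet
  refine Measure.le_iff.2 fun s hs => ?_
  change _ ≤ (noiseKernel νW ∘ₖ correctKernel νV hh hK Υ) y s
  rw [Kernel.comp_apply' _ _ _ hs, Measure.smul_apply, Measure.restrict_apply hs, smul_eq_mul]
  have hball : ENNReal.ofReal ε' ≤ correctKernel νV hh hK Υ y D := by
    rw [correctKernel, randomMap_apply,
      Measure.map_apply (measurable_conj_correct hh hK Υ).of_uncurry_left hDm]
    refine (ENNReal.ofReal_le_ofReal (hout (Υ * y * Υ⁻¹)).le).trans_eq ?_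
    rw [Measure.real, ENNReal.ofReal_toReal (measure_ne_top _ _)]
    rfl
  calc ENNReal.ofReal ε * ENNReal.ofReal ε' * Measure.haar (s ∩ D)
      = ENNReal.ofReal ε * Measure.haar (s ∩ D) * ENNReal.ofReal ε' := by ring
    _ ≤ ENNReal.ofReal ε * Measure.haar (s ∩ D) * correctKernel νV hh hK Υ y D := by gcongr
    _ = ∫⁻ _ in D, ENNReal.ofReal ε * Measure.haar (s ∩ D) ∂correctKernel νV hh hK Υ y :=
        (setLIntegral_const _ _).symm
    _ ≤ ∫⁻ c in D, noiseKernel νW c s ∂correctKernel νV hh hK Υ y := by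
        refine setLIntegral_mono' hDm fun c hc => ?_
        rw [noiseKernel, randomMap_apply, Measure.map_apply (measurable_mul_const c) hs,
          ← measure_preimage_mul_right Measure.haar c (s ∩ D)]
        refine (hdiff _ (measurable_mul_const c (hs.inter hDm)) fun w hw => ?_).trans
          (measure_mono fun w hw => hw.1)
        have hw2 := Metric.mem_ball.1 hw.2
        have hc2 := Metric.mem_ball.1 hc
        rw [Metric.mem_ball, ← hd _ _ c, one_mul]
        linarith [dist_triangle_right (w * c) c (noiselessStep h K Υ y)]
    _ ≤ _ := setLIntegral_le_lintegral _ _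

end Diffusivity

/-! ### Symmetries of the error kernel. -/

section Isotropy

variable {G 𝒴 : Type*} [Group G] [MeasurableSpace G]
  [MulAction G 𝒴] [MeasurableSpace 𝒴] [MeasurableSMul₂ G 𝒴] {p : ℕ}
  {h : G → Noise p → 𝒴} {K : 𝒴 → G} {νV : Measure (Noise p)}

lemma map_output_mul (hh : Measurable (Function.uncurry h)) (hequiv : LeftRightEquivariant h νV)
    {t : G} (ht : νV.map (h t) = νV.map (h 1)) (g : G) :
    νV.map (h (t * g)) = νV.map (h g) := by
  have key : ∀ x : G, νV.map (h (x * g)) = (νV.map (h x)).map (fun y => g⁻¹ • y) := fun x => by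
    rw [hequiv.law, Measure.map_map (measurable_const_smul _) hh.of_uncurry_left]
    rfl
  rw [key, ht, ← key, one_mul]

variable [MeasurableMul₂ G] [MeasurableInv G]

lemma map_correct_mul (hh : Measurable (Function.uncurry h)) (hK : Measurable K)
    (hequiv : LeftRightEquivariant h νV) {t : G} (ht : νV.map (h t) = νV.map (h 1)) (g : G) :
    νV.map (correct h K (t * g)) = (νV.map (correct h K g)).map (fun x => t * x) := by
  have hm : Measurable fun y => t * (g * (K y)⁻¹) := by fun_prop
  rw [Measure.map_map (measurable_const_mul t) (measurable_correct hh hK).of_uncurry_left]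
  have h1 : correct h K (t * g) = (fun y => t * (g * (K y)⁻¹)) ∘ h (t * g) := by
    funext v; simp [correct, mul_assoc]
  have h2 : (fun x => t * x) ∘ correct h K g = (fun y => t * (g * (K y)⁻¹)) ∘ h g := by
    funext v; simp [correct]
  rw [h1, h2, ← Measure.map_map hm hh.of_uncurry_left, map_output_mul hh hequiv ht,
    Measure.map_map hm hh.of_uncurry_left]

/-- Isotropy replaces `w` by `t * w * t⁻¹`; since `t` commutes with `Υ`, it then factors out on the
left of the predicted error, and the correction respects it in law. -/
lemma errorKernel_mul_left (νW : Measure G) [SFinite νW] [SFinite νV]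
    (hh : Measurable (Function.uncurry h)) (hK : Measurable K) (Υ : G)
    (hequiv : LeftRightEquivariant h νV) (hiso : IsIsotropic νW) {t : G} (htΥ : t * Υ = Υ * t)
    (ht : νV.map (h t) = νV.map (h 1)) (x : G) :
    errorKernel νW νV hh hK Υ (t * x) = (errorKernel νW νV hh hK Υ x).map (fun x => t * x) := by
  ext s hs
  have hm := measurable_const_mul t
  rw [Measure.map_apply hm hs, errorKernel_apply' νW νV hh hK Υ _ hs,
    errorKernel_apply' νW νV hh hK Υ _ (hm hs)]
  have hmeas : Measurable fun w => νV.map (correct h K (Υ * w * (t * x) * Υ⁻¹)) s := by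
    have := (Kernel.measurable_coe (correctKernel νV hh hK Υ) hs).comp
      (measurable_mul_const (t * x))
    simp only [correctKernel, Function.comp_def, randomMap_apply, ← mul_assoc] at this
    simpa only [← mul_assoc] using this
  conv_lhs => rw [← hiso t]
  rw [lintegral_map hmeas (by fun_prop)]
  refine lintegral_congr fun w => ?_
  have : Υ * (t * w * t⁻¹) * (t * x) * Υ⁻¹ = t * (Υ * w * x * Υ⁻¹) := by
    simp only [← mul_assoc, htΥ]
    group
  rw [this, map_correct_mul hh hK hequiv ht, Measure.map_apply hm hs]

lemma isStationary_map_mul_left (νW : Measure G) [SFinite νW] [SFinite νV]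
    (hh : Measurable (Function.uncurry h)) (hK : Measurable K) (Υ : G)
    (hequiv : LeftRightEquivariant h νV) (hiso : IsIsotropic νW) {t : G} (htΥ : t * Υ = Υ * t)
    (ht : νV.map (h t) = νV.map (h 1)) {π : Measure G} (hπ : IsStationary h K Υ νW νV π) :
    IsStationary h K Υ νW νV (π.map fun x => t * x) := by
  rw [isStationary_iff νW νV hh hK] at hπ ⊢
  have hm := measurable_const_mul t
  conv_rhs => rw [← hπ]
  ext s hs
  rw [Measure.bind_apply hs (Kernel.measurable _).aemeasurable, Measure.map_apply hm hs,
    Measure.bind_apply (hm hs) (Kernel.measurable _).aemeasurable,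
    lintegral_map (Kernel.measurable_coe _ hs) hm]
  refine lintegral_congr fun x => ?_
  rw [errorKernel_mul_left νW hh hK Υ hequiv hiso htΥ ht, Measure.map_apply hm hs]

end Isotropy

/-! ### Regrouping independent families. -/

section Independence

variable {Ω α β γ δ ι : Type*} [MeasurableSpace Ω] [MeasurableSpace α] [MeasurableSpace β]
  [MeasurableSpace γ] [MeasurableSpace δ] [MeasurableSpace ι] {P : Measure Ω}
  [IsProbabilityMeasure P] {I : Ω → ι} {A : Ω → α} {B : Ω → β} {C : Ω → γ} {D : Ω → δ}

lemma indepFun_prodMk_left (hA : Measurable A) (hB : Measurable B) (hC : Measurable C)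
    (h : IndepFun A (fun ω => (B ω, C ω)) P) (h' : IndepFun B C P) :
    IndepFun (fun ω => (A ω, B ω)) C P := by
  have hAB : IndepFun A B P := h.comp measurable_id measurable_fst
  rw [indepFun_iff_map_prod_eq_prod_map_map (by fun_prop) (by fun_prop)] at h h' hAB ⊢
  have := Measure.isProbabilityMeasure_map (μ := P) hA.aemeasurable
  have := Measure.isProbabilityMeasure_map (μ := P) hB.aemeasurable
  have := Measure.isProbabilityMeasure_map (μ := P) hC.aemeasurable
  rw [hAB, ← (MeasurableEquiv.prodAssoc (α := α) (β := β) (γ := γ)).map_measurableEquiv_injective.eq_iff,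
    Measure.prodAssoc_prod, Measure.map_map (MeasurableEquiv.measurable _) (by fun_prop), ← h', ← h]
  rfl

/-- Intended roles: `I` initial values, `A` and `C` past process and output noises, `B` and `D` the
fresh ones. -/
lemma indepFun_prodMk_prodMk (hI : Measurable I) (hA : Measurable A) (hB : Measurable B)
    (hC : Measurable C) (hD : Measurable D) (hAB : IndepFun A B P) (hCD : IndepFun C D P)
    (h : IndepFun (fun ω => (A ω, B ω)) (fun ω => (C ω, D ω)) P)
    (hinit : IndepFun I (fun ω => ((A ω, B ω), (C ω, D ω))) P) :
    IndepFun (fun ω => (I ω, (A ω, C ω))) (fun ω => (B ω, D ω)) P := by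
  have h1 : IndepFun (fun ω => ((A ω, B ω), C ω)) D P :=
    indepFun_prodMk_left (by fun_prop) hC hD h hCD
  have h2 : IndepFun (fun ω => (C ω, A ω)) B P :=
    indepFun_prodMk_left hC hA hB (h.comp measurable_id measurable_fst).symm hAB
  have h3 : IndepFun (fun ω => (D ω, B ω)) (fun ω => (C ω, A ω)) P :=
    indepFun_prodMk_left hD hB (by fun_prop)
      (h1.symm.comp measurable_id (ψ := fun z : (α × β) × γ => (z.1.2, (z.2, z.1.1)))
        (by fun_prop)) h2.symm
  have h4 : IndepFun (fun ω => (A ω, C ω)) (fun ω => (B ω, D ω)) P :=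
    h3.symm.comp measurable_swap measurable_swap
  exact indepFun_prodMk_left hI (by fun_prop) (by fun_prop)
    (hinit.comp measurable_id
      (ψ := fun z : (α × β) × (γ × δ) => ((z.1.1, z.2.1), (z.1.2, z.2.2))) (by fun_prop)) h4

/-- Extension of a finite family by a constant. -/
def extendBy (S : Finset ℕ) (b : α) (a : S → α) (n : ℕ) : α :=
  if hn : n ∈ S then a ⟨n, hn⟩ else b

lemma measurable_extendBy (S : Finset ℕ) (b : α) : Measurable (extendBy S b) := by
  refine measurable_pi_iff.2 fun n => ?_
  by_cases hn : n ∈ S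
  · simpa only [extendBy, hn, dif_pos] using measurable_pi_apply _
  · simpa only [extendBy, hn, dif_neg, not_false_iff] using measurable_const

lemma extendBy_apply {α : Type*} {S : Finset ℕ} (b : α) (a : ℕ → α) {n : ℕ} (hn : n ∈ S) :
    extendBy S b (fun i : S => a i) n = a n := by
  simp [extendBy, hn]

end Independence

/-! ### The law of the error along a run of the filter. -/

section Dynamics

variable {G 𝒴 : Type*} [Group G] {p : ℕ} {h : G → Noise p → 𝒴} {K : 𝒴 → G}

lemma state_congr (Υ : G) (u : ℕ → G) {W W' : ℕ → G} (χ₀ : G) {n : ℕ}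
    (hW : ∀ k < n, W k = W' k) : state Υ u W χ₀ n = state Υ u W' χ₀ n := by
  induction n with
  | zero => rfl
  | succ n ih =>
    rw [state, state, ih fun k hk => hW k (by omega), hW n (by omega)]

variable [MulAction G 𝒴]

lemma estimate_congr (Υ : G) (u : ℕ → G) {W W' : ℕ → G} {V V' : ℕ → Noise p} (χ₀ χhat₀ : G) {n : ℕ}
    (hW : ∀ k < n, W k = W' k) (hV : ∀ k < n + 1, V k = V' k) :
    estimate h K Υ u W V χ₀ χhat₀ n = estimate h K Υ u W' V' χ₀ χhat₀ n := by
  induction n with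
  | zero => rfl
  | succ n ih =>
    rw [estimate, estimate, ih (fun k hk => hW k (by omega)) fun k hk => hV k (by omega), obs, obs,
      state_congr Υ u χ₀ hW, hV (n + 1) (by omega)]

variable [MeasurableSpace G] [MeasurableMul₂ G]

/-- State and estimate at time `n` as a function of the initial values and the noises. -/
def run (h : G → Noise p → 𝒴) (K : 𝒴 → G) (Υ : G) (u : ℕ → G) (n : ℕ)
    (z : (G × G) × (ℕ → G) × (ℕ → Noise p)) : G × G :=
  (state Υ u z.2.1 z.1.1 n, estimate h K Υ u z.2.1 z.2.2 z.1.1 z.1.2 n)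

lemma measurable_state (Υ : G) (u : ℕ → G) (n : ℕ) :
    Measurable fun z : (G × G) × (ℕ → G) × (ℕ → Noise p) => state Υ u z.2.1 z.1.1 n := by
  induction n with
  | zero => exact measurable_fst.fst
  | succ n ih =>
    simp only [state]
    fun_prop

variable [MeasurableSpace 𝒴] [MeasurableSMul₂ G 𝒴]

lemma measurable_run (hh : Measurable (Function.uncurry h)) (hK : Measurable K) (Υ : G)
    (u : ℕ → G) (n : ℕ) : Measurable (run h K Υ u n) := by
  refine (measurable_state Υ u n).prodMk ?_
  induction n with
  | zero => exact measurable_fst.snd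
  | succ n ih =>
    simp only [estimate, filterStep, obs]
    have h1 := measurable_state (p := p) Υ u (n + 1)
    have h2 : Measurable fun z : (G × G) × (ℕ → G) × (ℕ → Noise p) =>
        h (state Υ u z.2.1 z.1.1 (n + 1)) (z.2.2 (n + 1)) :=
      hh.comp (h1.prodMk (by fun_prop))
    fun_prop

/-- Conditionally on the past and on the process noise, the next error has the law of the corrected
predicted error. -/
lemma map_filterStep [MeasurableInv G] (hh : Measurable (Function.uncurry h)) (hK : Measurable K)
    {νV : Measure (Noise p)} (hequiv : LeftRightEquivariant h νV) (Υ u χ χhat w : G) :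
    νV.map (fun v => Υ * w * χ * u * (filterStep K Υ u (h (Υ * w * χ * u) v) χhat)⁻¹) =
      νV.map (correct h K (Υ * w * (χ * χhat⁻¹) * Υ⁻¹)) := by
  set x := Υ * w * χ * u
  set g := Υ * χhat * u
  -- The input `u` cancels here.
  have hxg : Υ * w * (χ * χhat⁻¹) * Υ⁻¹ = x * g⁻¹ := by
    simp only [x, g]; group
  have hm : Measurable fun y => x * g⁻¹ * (K y)⁻¹ := by fun_prop
  have h1 : (fun v => x * (filterStep K Υ u (h x v) χhat)⁻¹)
      = (fun y => x * g⁻¹ * (K y)⁻¹) ∘ fun v => g • h x v := by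
    funext v; simp [filterStep, g, mul_assoc]
  have h2 : correct h K (x * g⁻¹) = (fun y => x * g⁻¹ * (K y)⁻¹) ∘ h (x * g⁻¹) := rfl
  have hs : Measurable fun v => g • h x v := (hh.of_uncurry_left (x := x)).const_smul g
  have hl := hequiv.law g⁻¹ x
  rw [inv_inv] at hl
  rw [h1, hxg, h2, ← Measure.map_map hm hs, ← hl, Measure.map_map hm hh.of_uncurry_left]

variable {Ω : Type*} [MeasurableSpace Ω] {P : Measure Ω} [IsProbabilityMeasure P]
  {νW : Measure G} {νV : Measure (Noise p)} {χ₀ χhat₀ : Ω → G} {W : ℕ → Ω → G} {V : ℕ → Ω → Noise p}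

lemma IsNoisyRun.map_run_prod (hrun : IsNoisyRun P νW νV χ₀ χhat₀ W V)
    (hh : Measurable (Function.uncurry h)) (hK : Measurable K) (Υ : G) (u : ℕ → G) (n : ℕ) :
    P.map (fun ω => (run h K Υ u n ((χ₀ ω, χhat₀ ω), fun k => W k ω, fun k => V k ω),
        (W n ω, V (n + 1) ω))) =
      (P.map fun ω => run h K Υ u n ((χ₀ ω, χhat₀ ω), fun k => W k ω, fun k => V k ω)).prod
        (νW.prod νV) := by
  have hmW := hrun.measurable_W
  have hmV := hrun.measurable_V
  have hmi : Measurable fun ω => (χ₀ ω, χhat₀ ω) :=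
    hrun.measurable_state.prodMk hrun.measurable_estimate
  have hAB := (hrun.indep_W.indepFun_finset (Finset.range n) {n} (by simp) hmW).comp
    measurable_id (measurable_pi_apply (⟨n, by simp⟩ : ({n} : Finset ℕ)))
  have hCD := (hrun.indep_V.indepFun_finset (Finset.range (n + 1)) {n + 1} (by simp) hmV).comp
    measurable_id (measurable_pi_apply (⟨n + 1, by simp⟩ : ({n + 1} : Finset ℕ)))
  have hφ : Measurable fun (a : ℕ → G) => ((fun i : Finset.range n => a i), a n) := by fun_prop
  have hψ : Measurable fun (a : ℕ → Noise p) =>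
    ((fun i : Finset.range (n + 1) => a i), a (n + 1)) := by fun_prop
  have hind := indepFun_prodMk_prodMk (P := P) (I := fun ω => (χ₀ ω, χhat₀ ω))
    (A := fun ω (i : Finset.range n) => W i ω) (B := W n)
    (C := fun ω (i : Finset.range (n + 1)) => V i ω) (D := V (n + 1)) hmi (by fun_prop) (hmW n)
    (by fun_prop) (hmV _) hAB hCD (hrun.indep_W_V.comp hφ hψ)
    (hrun.indep_init.comp measurable_id (hφ.prodMap hψ))
  have hWV : P.map (fun ω => (W n ω, V (n + 1) ω)) = νW.prod νV := by
    rw [(indepFun_iff_map_prod_eq_prod_map_map (hmW n).aemeasurable (hmV _).aemeasurable).1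
      (hrun.indep_W_V.comp (measurable_pi_apply n) (measurable_pi_apply (n + 1))),
      hrun.law_W, hrun.law_V]
  have hΦ : Measurable fun z : (G × G) × (Finset.range n → G) × (Finset.range (n + 1) → Noise p) =>
      run h K Υ u n (z.1, extendBy _ 1 z.2.1, extendBy _ 0 z.2.2) :=
    (measurable_run hh hK Υ u n).comp (measurable_fst.prodMk
      (((measurable_extendBy _ _).comp measurable_snd.fst).prodMk
        ((measurable_extendBy _ _).comp measurable_snd.snd)))
  -- At time `n` the run uses only `W k` for `k < n` and `V k` for `k ≤ n`, so the filler values `1`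
  -- and `0` are never read, and `W n`, `V (n + 1)` are fresh.
  have hrunω : (fun ω => run h K Υ u n ((χ₀ ω, χhat₀ ω), fun k => W k ω, fun k => V k ω)) =
      (fun z : (G × G) × (Finset.range n → G) × (Finset.range (n + 1) → Noise p) =>
        run h K Υ u n (z.1, extendBy _ 1 z.2.1, extendBy _ 0 z.2.2)) ∘
      fun ω => ((χ₀ ω, χhat₀ ω), (fun i : Finset.range n => W i ω),
        fun i : Finset.range (n + 1) => V i ω) := by
    funext ω
    have h1 : ∀ k < n, W k ω = extendBy (Finset.range n) 1 (fun i => W i ω) k := fun k hk =>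
      (extendBy_apply 1 (fun k => W k ω) (Finset.mem_range.2 hk)).symm
    have h2 : ∀ k < n + 1, V k ω = extendBy (Finset.range (n + 1)) 0 (fun i => V i ω) k :=
      fun k hk => (extendBy_apply 0 (fun k => V k ω) (Finset.mem_range.2 hk)).symm
    exact Prod.ext (state_congr Υ u _ h1) (estimate_congr Υ u _ _ h1 h2)
  have hfin := hind.comp hΦ measurable_id
  rw [← hrunω] at hfin
  have hmr : Measurable fun ω =>
      run h K Υ u n ((χ₀ ω, χhat₀ ω), fun k => W k ω, fun k => V k ω) :=
    (measurable_run hh hK Υ u n).comp (hmi.prodMk (by fun_prop))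
  rw [← hWV]
  exact (indepFun_iff_map_prod_eq_prod_map_map hmr.aemeasurable
    ((hmW n).prodMk (hmV _)).aemeasurable).1 hfin

variable [IsProbabilityMeasure νW] [IsProbabilityMeasure νV]

variable [MeasurableInv G]

lemma measurable_error (hh : Measurable (Function.uncurry h)) (hK : Measurable K) (Υ : G)
    (u : ℕ → G) (n : ℕ) : Measurable fun z : (G × G) × (ℕ → G) × (ℕ → Noise p) =>
      error h K Υ u z.2.1 z.2.2 z.1.1 z.1.2 n :=
  (measurable_run hh hK Υ u n).fst.mul (measurable_run hh hK Υ u n).snd.inv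

/-- The law of the error evolves by the error kernel, whatever the inputs. -/
lemma IsNoisyRun.map_error_succ (hrun : IsNoisyRun P νW νV χ₀ χhat₀ W V)
    (hh : Measurable (Function.uncurry h)) (hK : Measurable K)
    (hequiv : LeftRightEquivariant h νV) (Υ : G) (u : ℕ → G) (n : ℕ) :
    P.map (fun ω => error h K Υ u (fun k => W k ω) (fun k => V k ω) (χ₀ ω) (χhat₀ ω) (n + 1)) =
      errorKernel νW νV hh hK Υ ∘ₘ
        P.map (fun ω =>
          error h K Υ u (fun k => W k ω) (fun k => V k ω) (χ₀ ω) (χhat₀ ω) n) := by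
  have hmW := hrun.measurable_W
  have hmV := hrun.measurable_V
  have hmz : Measurable fun ω => ((χ₀ ω, χhat₀ ω), (fun k => W k ω), fun k => V k ω) :=
    (hrun.measurable_state.prodMk hrun.measurable_estimate).prodMk (by fun_prop)
  have hmr : Measurable fun ω =>
      run h K Υ u n ((χ₀ ω, χhat₀ ω), fun k => W k ω, fun k => V k ω) :=
    (measurable_run hh hK Υ u n).comp hmz
  set step : (G × G) × G × Noise p → G := fun z =>
    Υ * z.2.1 * z.1.1 * u n *
      (filterStep K Υ (u n) (h (Υ * z.2.1 * z.1.1 * u n) z.2.2) z.1.2)⁻¹ with hstep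
  have hms : Measurable step := by
    have hx : Measurable fun z : (G × G) × G × Noise p => Υ * z.2.1 * z.1.1 * u n := by fun_prop
    have hy : Measurable fun z : (G × G) × G × Noise p => h (Υ * z.2.1 * z.1.1 * u n) z.2.2 :=
      hh.comp (hx.prodMk (by fun_prop))
    simp only [hstep, filterStep]
    fun_prop
  have h1 : (fun ω => error h K Υ u (fun k => W k ω) (fun k => V k ω) (χ₀ ω) (χhat₀ ω) (n + 1)) =
      step ∘ fun ω => (run h K Υ u n ((χ₀ ω, χhat₀ ω), fun k => W k ω, fun k => V k ω),
        (W n ω, V (n + 1) ω)) := rfl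
  rw [h1, ← Measure.map_map hms (hmr.prodMk ((hmW n).prodMk (hmV _))),
    hrun.map_run_prod hh hK Υ u n]
  have h2 : (fun ω => error h K Υ u (fun k => W k ω) (fun k => V k ω) (χ₀ ω) (χhat₀ ω) n) =
      (fun z : G × G => z.1 * z.2⁻¹) ∘ fun ω =>
        run h K Υ u n ((χ₀ ω, χhat₀ ω), fun k => W k ω, fun k => V k ω) := rfl
  have hmd : Measurable fun z : G × G => z.1 * z.2⁻¹ := by fun_prop
  rw [h2, ← Measure.map_map hmd hmr]
  ext s hs
  rw [Measure.map_apply hms hs, Measure.prod_apply (hms hs),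
    Measure.bind_apply hs (Kernel.measurable _).aemeasurable,
    lintegral_map (Kernel.measurable_coe _ hs) hmd]
  -- Equivariance is only in law, so the next error is not compared pathwise: the past `z` and the
  -- noise `w` are frozen, and `map_filterStep` treats the law in `v`.
  refine lintegral_congr fun z => ?_
  rw [errorKernel_apply' νW νV hh hK Υ _ hs, Measure.prod_apply (measurable_prodMk_left (hms hs))]
  refine lintegral_congr fun w => ?_
  rw [← map_filterStep hh hK hequiv Υ (u n) z.1 z.2 w, Measure.map_apply _ hs]
  · rfl
  · exact hms.comp (measurable_prodMk_left.comp measurable_prodMk_left)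

end Dynamics

end InvariantFilter

/-! ### Assembly of the minorization, Doeblin's theorem and the symmetry. -/

theorem mainTheorem2
    {G : Type*} [Group G] [MetricSpace G] [IsTopologicalGroup G] [CompactSpace G]
    [MeasurableSpace G] [BorelSpace G]
    -- the distance is right-invariant
    (hd : ∀ x y z : G, dist (x * z) (y * z) = dist x y)
    {𝒴 : Type*} [TopologicalSpace 𝒴] [T2Space 𝒴] [MeasurableSpace 𝒴]
    [MulAction G 𝒴] [MeasurableSMul₂ G 𝒴]
    {p : ℕ}
    (νW : MeasureTheory.Measure G) [MeasureTheory.IsProbabilityMeasure νW]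
    (νV : MeasureTheory.Measure (InvariantFilter.Noise p)) [MeasureTheory.IsProbabilityMeasure νV]
    (h : G → InvariantFilter.Noise p → 𝒴) (hh : Measurable (Function.uncurry h))
    (hh0 : Continuous fun g => h g 0)
    (hequiv : InvariantFilter.LeftRightEquivariant h νV)
    (K : 𝒴 → G) (hK : Measurable K) (hK1 : K (h 1 0) = 1)
    (Υ : G) (α ε ε' : ℝ) (hα : 0 < α) (hε : 0 < ε) (hε' : 0 < ε')
    -- diffusivity of the process noise
    (hdiff : ∀ U : Set G, MeasurableSet U → U ⊆ Metric.ball 1 α →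
      ENNReal.ofReal ε * MeasureTheory.Measure.haar U ≤ νW U)
    -- reasonable output noise
    (hout : ∀ g : G, ε' < νV.real
      {v | InvariantFilter.correct h K g v ∈
        Metric.ball (InvariantFilter.correct h K g 0) (α / 2)})
    -- convergence of the noiseless output from almost every initial error
    (hconv : ∀ᵐ γ₀ : G ∂MeasureTheory.Measure.haar,
      Tendsto (fun n => h (InvariantFilter.noiseless h K Υ γ₀ n) 0) atTop (𝓝 (h 1 0)))
    -- continuity of the noiseless gain along almost every noiseless trajectory
    (hcont : ∀ᵐ γ₀ : G ∂MeasureTheory.Measure.haar, ∀ n : ℕ,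
      ContinuousAt (fun g => K (h g 0)) (InvariantFilter.noiselessPred h K Υ γ₀ n))
    (hconn : IsConnected (InvariantFilter.outputStabilizer h))
    (hΥ : h Υ 0 = h 1 0) :
    ∃ (π : MeasureTheory.Measure G) (_ : MeasureTheory.IsProbabilityMeasure π),
      InvariantFilter.IsStationary h K Υ νW νV π ∧
      (∀ π' : MeasureTheory.Measure G, MeasureTheory.IsProbabilityMeasure π' →
        InvariantFilter.IsStationary h K Υ νW νV π' → π' = π) ∧
      (∀ {Ω : Type*} [MeasurableSpace Ω] (P : MeasureTheory.Measure Ω)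
        [MeasureTheory.IsProbabilityMeasure P]
        (χ₀ χhat₀ : Ω → G) (W : ℕ → Ω → G) (V : ℕ → Ω → InvariantFilter.Noise p) (u : ℕ → G),
        InvariantFilter.IsNoisyRun P νW νV χ₀ χhat₀ W V →
        Tendsto (fun n => InvariantFilter.tvDist
            (P.map fun ω => InvariantFilter.error h K Υ u (fun k => W k ω) (fun k => V k ω)
              (χ₀ ω) (χhat₀ ω) n) π)
          atTop (𝓝 0)) ∧
      (InvariantFilter.IsIsotropic νW →
        ∀ t ∈ InvariantFilter.outputStabilizer h, t * Υ = Υ * t →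
          -- `t` preserves the law of the noisy output at the identity
          νV.map (h t) = νV.map (h 1) →
          ∀ A : Set G, MeasurableSet A → π ((fun x => t * x) '' A) = π A) := by
  obtain ⟨N, δ, hδ, c, hc, hN⟩ := InvariantFilter.exists_pow_ge_restrict_ball
    (P := InvariantFilter.noiseKernel νW * InvariantFilter.correctKernel νV hh hK Υ)
    (T := InvariantFilter.noiselessStep h K Υ) (H := MulAction.stabilizer G (h 1 0)) (t := Υ)
    hd (half_pos hα)
    (mul_ne_zero (ENNReal.ofReal_pos.2 hε).ne' (ENNReal.ofReal_pos.2 hε').ne')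
    (InvariantFilter.smul_restrict_ball_le_noise_mul_correct hd νW νV hh hK Υ hdiff hout)
    (InvariantFilter.outputStabilizer_eq hequiv ▸ hconn)
    (InvariantFilter.outputStabilizer_eq hequiv ▸ isClosed_eq hh0 continuous_const)
    (by
      rw [← SetLike.mem_coe, ← InvariantFilter.outputStabilizer_eq hequiv]
      exact hΥ)
    (fun s hs g => InvariantFilter.noiselessStep_mul hequiv Υ hΥ hs g)
    (hcont.mono fun γ hγ n => InvariantFilter.continuousAt_noiselessStep (hγ n))
    (hconv.mono fun γ hγ =>
      InvariantFilter.eventually_dist_noiseless_lt hequiv hh0 hγ (half_pos hα))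
  set m : Measure G := c • (Measure.haar : Measure G).restrict (Metric.ball 1 δ) with hm
  have hmfin : IsFiniteMeasure m := by
    have : IsProbabilityMeasure
        (((InvariantFilter.noiseKernel νW * InvariantFilter.correctKernel νV hh hK Υ) ^ N) 1) := by
      have : IsMarkovKernel
          (InvariantFilter.noiseKernel νW * InvariantFilter.correctKernel νV hh hK Υ) :=
        Kernel.IsMarkovKernel.comp _ _
      infer_instance
    exact isFiniteMeasure_of_le _ (hN 1)
  -- A Markov kernel preserves total mass, so the minorizing measure stays nonzero after the final
  -- correction.
  have hm0 : (InvariantFilter.correctKernel νV hh hK Υ ∘ₘ m) Set.univ ≠ 0 := by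
    rw [Measure.comp_apply_univ, hm]
    simpa [hc] using InvariantFilter.haar_ball_ne_zero (1 : G) hδ
  obtain ⟨π, hπp, hπ, hπu, hlim⟩ := InvariantFilter.doeblin
    (InvariantFilter.errorKernel νW νV hh hK Υ)
    (InvariantFilter.correctKernel νV hh hK Υ ∘ₘ m) (Nat.succ_pos N) (fun x => by
      rw [InvariantFilter.errorKernel_eq_mul]
      exact InvariantFilter.comp_le_mul_pow_succ _ _ hN x) hm0
  have hstat := InvariantFilter.isStationary_iff νW νV hh hK Υ
  refine ⟨π, hπp, (hstat π).2 hπ, fun π' hp' hπ' => hπu π' hp' ((hstat π').1 hπ'), ?_, ?_⟩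
  · intro Ω _ P _ χ₀ χhat₀ W V u hrun
    have hmz : Measurable fun ω => ((χ₀ ω, χhat₀ ω), (fun k => W k ω), fun k => V k ω) :=
      (hrun.measurable_state.prodMk hrun.measurable_estimate).prodMk
        ((measurable_pi_lambda _ hrun.measurable_W).prodMk
          (measurable_pi_lambda _ hrun.measurable_V))
    have hp : ∀ n, IsProbabilityMeasure (P.map fun ω => InvariantFilter.error h K Υ u
        (fun k => W k ω) (fun k => V k ω) (χ₀ ω) (χhat₀ ω) n) := fun n =>
      Measure.isProbabilityMeasure_map
        ((InvariantFilter.measurable_error hh hK Υ u n).comp hmz).aemeasurable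
    exact hlim _ fun n => hrun.map_error_succ hh hK hequiv Υ u n
  · intro hiso t _ htΥ ht A hA
    have hmt : Measurable fun x : G => t * x := measurable_const_mul t
    have hp : IsProbabilityMeasure (π.map fun x => t * x) :=
      Measure.isProbabilityMeasure_map hmt.aemeasurable
    have hinv : π.map (fun x => t * x) = π := hπu _ hp ((hstat _).1
      (InvariantFilter.isStationary_map_mul_left νW hh hK Υ hequiv hiso htΥ ht ((hstat π).2 hπ)))
    have hpre : (fun x => t * x) ⁻¹' ((fun x => t * x) '' A) = A :=
      Set.preimage_image_eq A (mul_right_injective t)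
    have hmA : MeasurableSet ((fun x => t * x) '' A) :=
      (MeasurableEquiv.mulLeft t).measurableSet_image.2 hA
    conv_lhs => rw [← hinv]
    rw [Measure.map_apply hmt hmA, hpre]
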